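/- Let $\mathcal{H},\mathcal{K}$ be finite-dimensional complex Hilbert spaces, $\rho$ a density operator on $\mathcal{H}$ (positive semi-definite, trace one), $\sigma\neq 0$ a positive semi-definite operator on $\mathcal{H}$, and $\mathcal{N}$ a quantum channel (linear, completely positive, trace-preserving map) from operators on $\mathcal{H}$ to operators on $\mathcal{K}$. Let $U:\mathcal{H}\to\mathcal{K}\otimes\mathcal{H}_E$ be an isometric extension of $\mathcal{N}$ with $\mathcal{H}_E$ finite-dimensional, i.e. $U^\dagger U=I$ and $\mathcal{N}(X)=\operatorname{Tr}_E\{UXU^\dagger\}$ for all $X$. Powers of positive semi-definite operators are taken on their support (zero eigenvalues are sent to $0$ for every exponent). For $\alpha\in[1/2,1)\cup(1,\infty]$ put $\alpha'=(\alpha-1)/\alpha$ ($\alpha'=1$ for $\alpha=\infty$) and $$\widetilde\Delta'_\alpha(\rho,\sigma,\mathcal{N})=\frac{2}{\alpha'}\max_{V_\sigma,V_{\mathcal{N}(\sigma)}}\log\left\Vert\left([\mathcal{N}(\rho)]^{-\alpha'/2}V_{\mathcal{N}(\sigma)}[\mathcal{N}(\sigma)]^{\alpha'/2}\otimes I_E\right)U\sigma^{-\alpha'/2}V_\sigma\rho^{1/2}\right\Vert_{2\alpha},$$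 where $V_\sigma$ and $V_{\mathcal{N}(\sigma)}$ range over the unitaries commuting with $\sigma$ and $\mathcal{N}(\sigma)$, respectively, $\Vert A\Vert_p=(\operatorname{Tr}|A|^p)^{1/p}$ is the Schatten $p$-norm (the operator norm for $p=\infty$), and $\log 0=-\infty$, so that $\widetilde\Delta'_\alpha\in[-\infty,+\infty]$. Then $\widetilde\Delta'_\alpha(\rho,\sigma,\mathcal{N})$ is monotone non-decreasing in $\alpha$: for all $1/2\le\alpha\le\gamma\le\infty$ with $\alpha\neq1$ and $\gamma\neq1$, $$\widetilde\Delta'_\alpha(\rho,\sigma,\mathcal{N})\le\widetilde\Delta'_\gamma(\rho,\sigma,\mathcal{N}),$$ where in the case $\alpha<1<\gamma$ it is assumed that $\operatorname{supp}(\rho)\subseteq\operatorname{supp}(\sigma)$ (no support condition is needed when $\alpha,\gamma<1$ or $\alpha,\gamma>1$). -/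

import Mathlib

open scoped Matrix Kronecker ENNReal ComplexOrder

noncomputable section

namespace SwiveledRenyi

variable {n k e : Type*} [Fintype n] [DecidableEq n] [Fintype k] [DecidableEq k]
  [Fintype e] [DecidableEq e]

/-- A density operator: a positive semi-definite operator of trace one. -/
def IsDensity (ρ : Matrix n n ℂ) : Prop := ρ.PosSemidef ∧ ρ.trace = 1

/-- The support of a Hermitian operator, i.e. the span of its eigenvectors with non-zero
eigenvalue; for a Hermitian operator this is its range. -/
def supp (A : Matrix n n ℂ) : Submodule ℂ (n → ℂ) := LinearMap.range A.mulVecLin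

/-- The real power `A ^ s` of a positive semi-definite operator, evaluated on the support of `A`:
zero eigenvalues are sent to `0`, whatever the exponent is. -/
def matPow (A : Matrix n n ℂ) (s : ℝ) : Matrix n n ℂ :=
  cfc (fun x : ℝ => if x = 0 then 0 else x ^ s) A

/-- `|A| = √(A† A)`. -/
def matAbs (A : Matrix k n ℂ) : Matrix n n ℂ := matPow (Aᴴ * A) (1 / 2)

open scoped Matrix.Norms.L2Operator in
/-- The Schatten `p`-norm `(Tr |A| ^ p) ^ (1 / p)`; for `p = ∞` it is the operator norm with
respect to the Euclidean norms. -/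
def schattenNorm (p : ℝ≥0∞) (A : Matrix k n ℂ) : ℝ :=
  if p = ⊤ then ‖A‖ else (matPow (matAbs A) p.toReal).trace.re ^ (1 / p.toReal)

/-- The partial trace over the second tensor factor. -/
def partialTrace (M : Matrix (k × e) (k × e) ℂ) : Matrix k k ℂ :=
  Matrix.of fun i j => ∑ a, M (i, a) (j, a)

/-- The ampliation `Φ ⊗ id` on operators with an ancilla of dimension `r`. -/
def ampliation (Φ : Matrix n n ℂ →ₗ[ℂ] Matrix k k ℂ) (r : ℕ)
    (X : Matrix (n × Fin r) (n × Fin r) ℂ) : Matrix (k × Fin r) (k × Fin r) ℂ :=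
  Matrix.of fun x y => Φ (Matrix.of fun i j => X (i, x.2) (j, y.2)) x.1 y.1

/-- A quantum channel: a linear, completely positive, trace-preserving map. -/
def IsQuantumChannel (Φ : Matrix n n ℂ →ₗ[ℂ] Matrix k k ℂ) : Prop :=
  (∀ (r : ℕ) (X : Matrix (n × Fin r) (n × Fin r) ℂ), X.PosSemidef → (ampliation Φ r X).PosSemidef)
    ∧ ∀ X, (Φ X).trace = X.trace

/-- `U : ℂⁿ → ℂᵏ ⊗ ℂᵉ` is an isometric extension of `Φ`: it is an isometry and
`Φ X = Tr_E (U X U†)` for all `X`. -/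
def IsIsometricExtension (Φ : Matrix n n ℂ →ₗ[ℂ] Matrix k k ℂ) (U : Matrix (k × e) n ℂ) : Prop :=
  Uᴴ * U = 1 ∧ ∀ X, Φ X = partialTrace (U * X * Uᴴ)

/-- The set of unitaries that commute with `A`. -/
def swivels (A : Matrix n n ℂ) : Set (Matrix n n ℂ) :=
  {V | V ∈ Matrix.unitaryGroup n ℂ ∧ Commute V A}

/-- The parameter `α' = (α - 1) / α`, which is `1` for `α = ∞`. -/
def dualParam (α : ℝ≥0∞) : ℝ := if α = ⊤ then 1 else (α.toReal - 1) / α.toReal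

/-- The operator
`([Φ ρ]^{-α'/2} W [Φ σ]^{α'/2} ⊗ I_E) U σ^{-α'/2} V ρ^{1/2}`. -/
def swiveledChain (ρ σ : Matrix n n ℂ) (Φ : Matrix n n ℂ →ₗ[ℂ] Matrix k k ℂ)
    (U : Matrix (k × e) n ℂ) (α : ℝ≥0∞) (V : Matrix n n ℂ) (W : Matrix k k ℂ) :
    Matrix (k × e) n ℂ :=
  ((matPow (Φ ρ) (-dualParam α / 2) * W * matPow (Φ σ) (dualParam α / 2)) ⊗ₖ
      (1 : Matrix e e ℂ)) * U * matPow σ (-dualParam α / 2) * V * matPow ρ (1 / 2)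

/-- The sandwiched-type swiveled Rényi quantity
`(2 / α') max_{V, W} log ‖([Φ ρ]^{-α'/2} W [Φ σ]^{α'/2} ⊗ I_E) U σ^{-α'/2} V ρ^{1/2}‖_{2α}`,
the maximum over unitaries `V`, `W` commuting with `σ`, `Φ σ`. It takes values in the extended
reals, with `log 0 = -∞`. -/
def sandwichedDelta (ρ σ : Matrix n n ℂ) (Φ : Matrix n n ℂ →ₗ[ℂ] Matrix k k ℂ)
    (U : Matrix (k × e) n ℂ) (α : ℝ≥0∞) : EReal :=
  ((2 / dualParam α : ℝ) : EReal) *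
    ⨆ V ∈ swivels σ, ⨆ W ∈ swivels (Φ σ),
      ENNReal.log (ENNReal.ofReal (schattenNorm (2 * α) (swiveledChain ρ σ Φ U α V W)))

end SwiveledRenyi

end

/-! Replace `α'` by a complex variable `z` in the operator chain; this gives an entire family `F z`.
On the line `Re z = x` the imaginary powers of `σ` and `N(σ)` are unitaries commuting with `σ` and
`N(σ)`, so they merge with the swivels, while the imaginary power of `N(ρ)` is a unitary on the far
left and does not affect the norm. Since `2α = 2 / (1 - α')`, the maximum `M(x)` over the swivels of
the Schatten `2/(1-x)`-norm of the real chain bounds `F` on that whole line. This is the role of the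
swivels.

Complex interpolation (`schattenNorm_le_interp`) then gives a convexity bound for `log M` on `[-1,
1]`. At `x = 0` the chain is a contraction times `ρ^{1/2}`, so `log M(0) ≤ 0`, and the slope `log
M(x) / x` is monotone on each side of `0`. To cross `0` one needs `log M(0) ≥ 0`: under the support
condition the chain with trivial swivels is `U ρ^{1/2}`, of 2-norm one.

The interpolation applies the three lines theorem to `Tr(P^{(1+z)/2} K F(z))`, with `P` and `K`
taken from the polar decomposition at the target point; trace Hölder (`norm_trace_matPow_mul_le`)
controls the boundary lines. -/

namespace SwiveledRenyi

open Matrix Complex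

/-! ### Real and complex powers of Hermitian matrices; imaginary powers as swivels. -/

section FunctionalCalculus

variable {n : Type*} [Fintype n] [DecidableEq n] {A : Matrix n n ℂ}

/-- The complex-valued functional calculus of a Hermitian matrix. -/
noncomputable def fcalc (hA : A.IsHermitian) (f : ℝ → ℂ) : Matrix n n ℂ :=
  (hA.eigenvectorUnitary : Matrix n n ℂ) * diagonal (fun i => f (hA.eigenvalues i)) *
    (hA.eigenvectorUnitary : Matrix n n ℂ)ᴴ

lemma eigenvectorUnitary_conjTranspose_mul (hA : A.IsHermitian) :
    (hA.eigenvectorUnitary : Matrix n n ℂ)ᴴ * (hA.eigenvectorUnitary : Matrix n n ℂ) = 1 :=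
  Unitary.coe_star_mul_self hA.eigenvectorUnitary

lemma eigenvectorUnitary_mul_conjTranspose (hA : A.IsHermitian) :
    (hA.eigenvectorUnitary : Matrix n n ℂ) * (hA.eigenvectorUnitary : Matrix n n ℂ)ᴴ = 1 :=
  Unitary.coe_mul_star_self hA.eigenvectorUnitary

lemma fcalc_mul (hA : A.IsHermitian) (f g : ℝ → ℂ) :
    fcalc hA f * fcalc hA g = fcalc hA (fun x => f x * g x) := by
  have h := eigenvectorUnitary_conjTranspose_mul hA
  unfold fcalc
  set U := (hA.eigenvectorUnitary : Matrix n n ℂ)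
  calc _ = U * diagonal (fun i => f (hA.eigenvalues i)) * (Uᴴ * U) *
        diagonal (fun i => g (hA.eigenvalues i)) * Uᴴ := by simp only [Matrix.mul_assoc]
    _ = _ := by rw [h, Matrix.mul_one, Matrix.mul_assoc U, diagonal_mul_diagonal]

lemma fcalc_congr (hA : A.IsHermitian) {f g : ℝ → ℂ}
    (h : ∀ i, f (hA.eigenvalues i) = g (hA.eigenvalues i)) : fcalc hA f = fcalc hA g := by
  simp only [fcalc, h]

lemma fcalc_conjTranspose (hA : A.IsHermitian) (f : ℝ → ℂ) :
    (fcalc hA f)ᴴ = fcalc hA (fun x => star (f x)) := by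
  simp [fcalc, Matrix.mul_assoc, diagonal_conjTranspose, Pi.star_def]

lemma fcalc_one (hA : A.IsHermitian) : fcalc hA (fun _ => 1) = 1 := by
  simp [fcalc, eigenvectorUnitary_mul_conjTranspose]

lemma fcalc_ofReal (hA : A.IsHermitian) (f : ℝ → ℝ) :
    fcalc hA (fun x => (f x : ℂ)) = cfc f A := by
  rw [hA.cfc_eq, IsHermitian.cfc, Unitary.conjStarAlgAut_apply]
  rfl

lemma fcalc_id (hA : A.IsHermitian) : fcalc hA (fun x => (x : ℂ)) = A := by
  rw [fcalc_ofReal hA (fun x => x)]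
  exact cfc_id' ℝ A hA

lemma fcalc_commute (hA : A.IsHermitian) (f : ℝ → ℂ) : Commute (fcalc hA f) A := by
  have h : fcalc hA f * fcalc hA (fun x => (x : ℂ)) = fcalc hA (fun x => (x : ℂ)) * fcalc hA f := by
    rw [fcalc_mul, fcalc_mul]
    simp only [mul_comm]
  rwa [fcalc_id] at h

open scoped Matrix.Norms.L2Operator in
lemma norm_le_one_of_conjTranspose_mul_self {k m : Type*} [Fintype k] [Fintype m] [DecidableEq m]
    {B : Matrix k m ℂ} (hB : ‖Bᴴ * B‖ ≤ 1) : ‖B‖ ≤ 1 := by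
  rw [l2_opNorm_conjTranspose_mul_self] at hB
  nlinarith [norm_nonneg B]

open scoped Matrix.Norms.L2Operator in
lemma norm_one_matrix_le_one {m : Type*} [Fintype m] [DecidableEq m] :
    ‖(1 : Matrix m m ℂ)‖ ≤ 1 := by
  rw [← diagonal_one, l2_opNorm_diagonal]
  exact (pi_norm_le_iff_of_nonneg zero_le_one).2 fun i => by simp

open scoped Matrix.Norms.L2Operator in
lemma norm_le_one_of_isometry {k m : Type*} [Fintype k] [Fintype m] [DecidableEq m]
    {B : Matrix k m ℂ} (hB : Bᴴ * B = 1) : ‖B‖ ≤ 1 :=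
  norm_le_one_of_conjTranspose_mul_self (hB ▸ norm_one_matrix_le_one)

open scoped Matrix.Norms.L2Operator in
lemma norm_le_one_of_isProj {m : Type*} [Fintype m] [DecidableEq m]
    {B : Matrix m m ℂ} (hB : Bᴴ * B = B) : ‖B‖ ≤ 1 := by
  have h := l2_opNorm_conjTranspose_mul_self B
  rw [hB] at h
  nlinarith [norm_nonneg B]

lemma fcalc_unitary (hA : A.IsHermitian) {f : ℝ → ℂ} (hf : ∀ x, star (f x) * f x = 1) :
    (fcalc hA f)ᴴ * fcalc hA f = 1 := by
  rw [fcalc_conjTranspose, fcalc_mul, ← fcalc_one hA]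
  exact fcalc_congr hA fun i => hf _

/-- The complex power `A ^ z`, evaluated on the support of `A`. -/
noncomputable def matCpow (hA : A.IsHermitian) (z : ℂ) : Matrix n n ℂ :=
  fcalc hA (fun x => if x = 0 then 0 else (x : ℂ) ^ z)

/-- The unitary `A ^ (i y)`, acting as the identity on the kernel of `A`. -/
noncomputable def matPhase (hA : A.IsHermitian) (y : ℝ) : Matrix n n ℂ :=
  -- Cutting at `x ≤ 0` rather than `x = 0` makes the function unimodular on all of `ℝ`, so
  -- unitarity needs no positivity of `A`.
  fcalc hA (fun x => if x ≤ 0 then 1 else (x : ℂ) ^ ((y : ℂ) * I))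

lemma matCpow_add (hA : A.IsHermitian) (z w : ℂ) :
    matCpow hA (z + w) = matCpow hA z * matCpow hA w := by
  rw [matCpow, matCpow, matCpow, fcalc_mul]
  refine fcalc_congr hA fun i => ?_
  split_ifs with h
  · simp
  · exact cpow_add _ _ (by exact_mod_cast h)

lemma matPow_eq_matCpow (hA : A.PosSemidef) (s : ℝ) : matPow A s = matCpow hA.isHermitian s := by
  rw [matPow, ← fcalc_ofReal hA.isHermitian, matCpow]
  refine fcalc_congr _ fun i => ?_
  split_ifs with h
  · simp
  · exact ofReal_cpow (hA.eigenvalues_nonneg i) s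

lemma matPow_add (hA : A.PosSemidef) (s t : ℝ) : matPow A (s + t) = matPow A s * matPow A t := by
  simp only [matPow_eq_matCpow hA, ofReal_add, matCpow_add]

lemma matPow_one (hA : A.PosSemidef) : matPow A 1 = A := by
  conv_rhs => rw [← fcalc_id hA.isHermitian]
  rw [matPow_eq_matCpow hA, matCpow]
  refine fcalc_congr _ fun i => ?_
  split_ifs with h
  · simp [h]
  · simp

lemma matPow_isHermitian (A : Matrix n n ℂ) (s : ℝ) : (matPow A s).IsHermitian :=
  cfc_predicate _ _

lemma matPow_posSemidef (hA : A.PosSemidef) (s : ℝ) : (matPow A s).PosSemidef := by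
  have h : matPow A s = (matPow A (s / 2))ᴴ * matPow A (s / 2) := by
    rw [(matPow_isHermitian A _).eq, ← matPow_add hA, add_halves]
  exact h ▸ posSemidef_conjTranspose_mul_self _

lemma matPow_matPow (hA : A.PosSemidef) (s t : ℝ) : matPow (matPow A s) t = matPow A (s * t) := by
  have hsp := finite_real_spectrum (A := A)
  rw [matPow, matPow, matPow]
  refine (cfc_comp' (fun x : ℝ => if x = 0 then 0 else x ^ t) (fun x => if x = 0 then 0 else x ^ s)
    A ((hsp.image _).continuousOn _) (hsp.continuousOn _) hA.isHermitian).symm.trans ?_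
  refine cfc_congr fun x hx => ?_
  have hx0 : 0 ≤ x := by
    obtain ⟨i, rfl⟩ := hA.isHermitian.spectrum_real_eq_range_eigenvalues ▸ hx
    exact hA.eigenvalues_nonneg i
  by_cases h : x = 0
  · simp [h]
  · have : x ^ s ≠ 0 := (Real.rpow_pos_of_pos (lt_of_le_of_ne hx0 (Ne.symm h)) s).ne'
    simp [h, this, Real.rpow_mul hx0]

lemma trace_posSemidef_eq {m : Type*} [Fintype m] {A : Matrix m m ℂ} (hA : A.PosSemidef) :
    A.trace = (A.trace.re : ℂ) := by
  have h := hA.trace_nonneg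
  rw [Complex.le_def] at h
  exact Complex.ext rfl (by simpa using h.2.symm)

lemma trace_re_nonneg {m : Type*} [Fintype m] {A : Matrix m m ℂ} (hA : A.PosSemidef) :
    0 ≤ A.trace.re := by
  have h := hA.trace_nonneg
  rw [Complex.le_def] at h
  exact h.1

lemma matPhase_conjTranspose_mul (hA : A.IsHermitian) (y : ℝ) :
    (matPhase hA y)ᴴ * matPhase hA y = 1 := by
  refine fcalc_unitary hA fun x => ?_
  split_ifs with h
  · simp
  · have h0 : 0 < x := not_le.1 h
    have : ‖(x : ℂ) ^ ((y : ℂ) * I)‖ = 1 := by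
      rw [norm_cpow_eq_rpow_re_of_pos h0]
      simp
    rw [RCLike.star_def, Complex.conj_mul', this]
    simp

lemma matPhase_mem_swivels (hA : A.IsHermitian) (y : ℝ) : matPhase hA y ∈ swivels A :=
  ⟨mem_unitaryGroup_iff'.2 (matPhase_conjTranspose_mul hA y), fcalc_commute hA _⟩

/-- On the kernel both sides vanish through `matPow`, so the value chosen there for the phase is
harmless. -/
lemma matCpow_eq_mul_matPhase (hA : A.PosSemidef) (z : ℂ) :
    matCpow hA.isHermitian z = matPow A z.re * matPhase hA.isHermitian z.im := by
  rw [matPow_eq_matCpow hA, matCpow, matCpow, matPhase, fcalc_mul]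
  refine fcalc_congr _ fun i => ?_
  split_ifs with h h' h'
  · simp
  · simp
  · exact absurd (le_antisymm h' (hA.eigenvalues_nonneg i)) h
  · rw [← cpow_add _ _ (by exact_mod_cast h), re_add_im]

lemma matCpow_eq_matPhase_mul (hA : A.PosSemidef) (z : ℂ) :
    matCpow hA.isHermitian z = matPhase hA.isHermitian z.im * matPow A z.re := by
  rw [matCpow_eq_mul_matPhase hA, matPow_eq_matCpow hA, matCpow, matPhase, fcalc_mul, fcalc_mul]
  simp only [mul_comm]

lemma mul_swivels {V W : Matrix n n ℂ} (hV : V ∈ swivels A) (hW : W ∈ swivels A) :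
    V * W ∈ swivels A :=
  ⟨mul_mem hV.1 hW.1, hV.2.mul_left hW.2⟩

lemma one_mem_swivels : (1 : Matrix n n ℂ) ∈ swivels A := ⟨one_mem _, Commute.one_left _⟩

end FunctionalCalculus

/-! ### The trace Hölder inequality. -/

section Holder

/-- A weighted Hölder inequality for doubly substochastic weights. -/
lemma sum_substochastic_mul_rpow_le {ι κ : Type*} [Fintype ι] [Fintype κ] {d : ι → κ → ℝ}
    (hd : ∀ i j, 0 ≤ d i j) (hrow : ∀ i, ∑ j, d i j ≤ 1) (hcol : ∀ j, ∑ i, d i j ≤ 1)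
    {l : ι → ℝ} {r : κ → ℝ} (hl : ∀ i, 0 ≤ l i) (hr : ∀ j, 0 ≤ r j) {a b : ℝ} (ha : 0 ≤ a)
    (hb : 0 ≤ b) (hab : a + b = 1) :
    ∑ i, ∑ j, d i j * ((if l i = 0 then 0 else l i ^ a) * (if r j = 0 then 0 else r j ^ b)) ≤
      (∑ i, l i) ^ a * (∑ j, r j) ^ b := by
  set L := ∑ i, l i with hL
  set R := ∑ j, r j with hR
  have hL0 : 0 ≤ L := Finset.sum_nonneg fun i _ => hl i
  have hR0 : 0 ≤ R := Finset.sum_nonneg fun i _ => hr i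
  have hrhs : 0 ≤ L ^ a * R ^ b := mul_nonneg (Real.rpow_nonneg hL0 _) (Real.rpow_nonneg hR0 _)
  rcases hL0.eq_or_lt with h | hLpos
  · have h0 : ∀ i, l i = 0 := fun i =>
      (Finset.sum_eq_zero_iff_of_nonneg fun i _ => hl i).1 h.symm i (Finset.mem_univ i)
    simpa [h0] using hrhs
  rcases hR0.eq_or_lt with h | hRpos
  · have h0 : ∀ i, r i = 0 := fun i =>
      (Finset.sum_eq_zero_iff_of_nonneg fun i _ => hr i).1 h.symm i (Finset.mem_univ i)
    simpa [h0] using hrhs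
  -- Weighted AM-GM for the normalised entries `l i / L` and `r j / R`; sending zero entries to `0`
  -- can only lower the left side.
  have key : ∀ i j, (if l i = 0 then 0 else l i ^ a) * (if r j = 0 then 0 else r j ^ b) ≤
      L ^ a * R ^ b * (a * (l i / L) + b * (r j / R)) := by
    intro i j
    have h1 := Real.geom_mean_le_arith_mean2_weighted ha hb (div_nonneg (hl i) hL0)
      (div_nonneg (hr j) hR0) hab
    have h2 : l i ^ a * r j ^ b = L ^ a * R ^ b * ((l i / L) ^ a * (r j / R) ^ b) := by
      rw [Real.div_rpow (hl i) hL0, Real.div_rpow (hr j) hR0]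
      have := (Real.rpow_pos_of_pos hLpos a).ne'
      have := (Real.rpow_pos_of_pos hRpos b).ne'
      field_simp
    have h3 : (if l i = 0 then 0 else l i ^ a) * (if r j = 0 then 0 else r j ^ b) ≤
        l i ^ a * r j ^ b := by
      have := Real.rpow_nonneg (hl i) a
      have := Real.rpow_nonneg (hr j) b
      split_ifs <;> simp only [zero_mul, mul_zero, le_refl] <;> positivity
    exact h3.trans (h2 ▸ mul_le_mul_of_nonneg_left h1 hrhs)
  calc _ ≤ ∑ i, ∑ j, d i j * (L ^ a * R ^ b * (a * (l i / L) + b * (r j / R))) :=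
        Finset.sum_le_sum fun i _ => Finset.sum_le_sum fun j _ =>
          mul_le_mul_of_nonneg_left (key i j) (hd i j)
    _ = L ^ a * R ^ b * (a * ((∑ i, (∑ j, d i j) * l i) / L) +
          b * ((∑ j, (∑ i, d i j) * r j) / R)) := by
        have e1 : ∑ i, (∑ j, d i j) * l i = ∑ i, ∑ j, d i j * l i := by
          simp only [Finset.sum_mul]
        have e2 : ∑ j, (∑ i, d i j) * r j = ∑ i, ∑ j, d i j * r j := by
          simp only [Finset.sum_mul]
          exact Finset.sum_comm
        rw [e1, e2]
        simp only [Finset.sum_div, Finset.mul_sum, ← Finset.sum_add_distrib]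
        refine Finset.sum_congr rfl fun i _ => Finset.sum_congr rfl fun j _ => ?_
        ring
    _ ≤ L ^ a * R ^ b * (a * 1 + b * 1) := by
        refine mul_le_mul_of_nonneg_left (add_le_add (mul_le_mul_of_nonneg_left ?_ ha)
          (mul_le_mul_of_nonneg_left ?_ hb)) hrhs
        · exact (div_le_one hLpos).2 (Finset.sum_le_sum fun i _ =>
            mul_le_of_le_one_left (hl i) (hrow i))
        · exact (div_le_one hRpos).2 (Finset.sum_le_sum fun j _ =>
            mul_le_of_le_one_left (hr j) (hcol j))
    _ = L ^ a * R ^ b := by rw [mul_one, mul_one, hab, mul_one]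

open scoped Matrix.Norms.L2Operator

lemma sum_col_sq_le_one {k n : Type*} [Fintype k] [Fintype n] [DecidableEq n] {X : Matrix k n ℂ}
    (hX : ‖X‖ ≤ 1) (j : n) : ∑ i, ‖X i j‖ ^ 2 ≤ 1 := by
  have h := l2_opNorm_mulVec X (EuclideanSpace.single j 1)
  rw [PiLp.norm_single, norm_one, mul_one] at h
  have h2 := h.trans hX
  rw [EuclideanSpace.norm_eq, Real.sqrt_le_iff] at h2
  simpa using h2

lemma sum_row_sq_le_one {k n : Type*} [Fintype k] [DecidableEq k] [Fintype n] [DecidableEq n]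
    {X : Matrix k n ℂ} (hX : ‖X‖ ≤ 1) (i : k) : ∑ j, ‖X i j‖ ^ 2 ≤ 1 := by
  have h := sum_col_sq_le_one (X := Xᴴ) (by rwa [l2_opNorm_conjTranspose]) i
  simpa using h

lemma norm_mul_le_one {k n m : Type*} [Fintype k] [Fintype n] [DecidableEq n] [Fintype m]
    [DecidableEq m] {A : Matrix k n ℂ} {B : Matrix n m ℂ} (hA : ‖A‖ ≤ 1) (hB : ‖B‖ ≤ 1) :
    ‖A * B‖ ≤ 1 :=
  (l2_opNorm_mul A B).trans (mul_le_one₀ hA (norm_nonneg _) hB)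

variable {n : Type*} [Fintype n] [DecidableEq n]

/-- In the two eigenbases the trace has weights `X i j * Y j i` with `X = U†CV` and `Y = V†U`
contractions. Their moduli are at most `(|X i j|² + |Y j i|²) / 2`, which is doubly substochastic
because rows and columns of a contraction have 2-norm at most one. -/
lemma norm_trace_diagonal_mul_le {U V C : Matrix n n ℂ} (nU : ‖U‖ ≤ 1) (nV : ‖V‖ ≤ 1)
    (hC : ‖C‖ ≤ 1) {l r : n → ℝ} (hl : ∀ i, 0 ≤ l i) (hr : ∀ j, 0 ≤ r j) {a b : ℝ} (ha : 0 ≤ a)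
    (hb : 0 ≤ b) (hab : a + b = 1) :
    ‖(U * diagonal (fun i => ((if l i = 0 then 0 else l i ^ a : ℝ) : ℂ)) * Uᴴ * C *
      (V * diagonal (fun i => ((if r i = 0 then 0 else r i ^ b : ℝ) : ℂ)) * Vᴴ)).trace‖ ≤
      (∑ i, l i) ^ a * (∑ j, r j) ^ b := by
  set f : n → ℝ := fun i => if l i = 0 then 0 else l i ^ a with hf
  set g : n → ℝ := fun i => if r i = 0 then 0 else r i ^ b with hg
  have hf0 : ∀ i, 0 ≤ f i := fun i => by
    simp only [hf]; split_ifs; exacts [le_rfl, Real.rpow_nonneg (hl i) _]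
  have hg0 : ∀ i, 0 ≤ g i := fun i => by
    simp only [hg]; split_ifs; exacts [le_rfl, Real.rpow_nonneg (hr i) _]
  set X := Uᴴ * C * V
  set Y := Vᴴ * U
  have nX : ‖X‖ ≤ 1 :=
    norm_mul_le_one (norm_mul_le_one (by rwa [l2_opNorm_conjTranspose]) hC) nV
  have nY : ‖Y‖ ≤ 1 := norm_mul_le_one (by rwa [l2_opNorm_conjTranspose]) nU
  have htr : (U * diagonal (fun i => (f i : ℂ)) * Uᴴ * C *
      (V * diagonal (fun i => (g i : ℂ)) * Vᴴ)).trace =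
      ∑ i, ∑ j, (f i : ℂ) * X i j * ((g j : ℂ) * Y j i) := by
    calc _ = (U * (diagonal (fun i => (f i : ℂ)) * X * (diagonal (fun i => (g i : ℂ)) * Vᴴ))).trace
          := by simp only [X, Matrix.mul_assoc]
      _ = ((diagonal (fun i => (f i : ℂ)) * X) * (diagonal (fun i => (g i : ℂ)) * Y)).trace := by
          rw [Matrix.trace_mul_comm]
          simp only [Y, Matrix.mul_assoc]
      _ = _ := by
          simp only [Matrix.trace, Matrix.diag, Matrix.mul_apply (M := diagonal _ * X),
            Matrix.diagonal_mul]
  have hd : ∀ i j, ‖X i j‖ * ‖Y j i‖ ≤ (‖X i j‖ ^ 2 + ‖Y j i‖ ^ 2) / 2 := fun i j => by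
    nlinarith [sq_nonneg (‖X i j‖ - ‖Y j i‖)]
  rw [htr]
  calc _ ≤ ∑ i, ∑ j, ‖(f i : ℂ) * X i j * ((g j : ℂ) * Y j i)‖ :=
        (norm_sum_le _ _).trans (Finset.sum_le_sum fun i _ => norm_sum_le _ _)
    _ ≤ ∑ i, ∑ j, (‖X i j‖ ^ 2 + ‖Y j i‖ ^ 2) / 2 * (f i * g j) := by
        refine Finset.sum_le_sum fun i _ => Finset.sum_le_sum fun j _ => ?_
        rw [norm_mul, norm_mul, norm_mul, Complex.norm_real, Complex.norm_real,
          Real.norm_of_nonneg (hf0 i), Real.norm_of_nonneg (hg0 j)]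
        calc _ = ‖X i j‖ * ‖Y j i‖ * (f i * g j) := by ring
          _ ≤ _ := mul_le_mul_of_nonneg_right (hd i j) (mul_nonneg (hf0 i) (hg0 j))
    _ ≤ _ := by
        refine sum_substochastic_mul_rpow_le (fun i j => by positivity) (fun i => ?_) (fun j => ?_)
          hl hr ha hb hab
        · rw [← Finset.sum_div, Finset.sum_add_distrib]
          linarith [sum_row_sq_le_one nX i, sum_col_sq_le_one nY i]
        · rw [← Finset.sum_div, Finset.sum_add_distrib]
          linarith [sum_col_sq_le_one nX j, sum_row_sq_le_one nY j]

/-- The Hölder inequality for the trace. -/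
theorem norm_trace_matPow_mul_le {P Q C : Matrix n n ℂ} (hP : P.PosSemidef) (hQ : Q.PosSemidef)
    (hC : ‖C‖ ≤ 1) {a b : ℝ} (ha : 0 ≤ a) (hb : 0 ≤ b) (hab : a + b = 1) :
    ‖(matPow P a * C * matPow Q b).trace‖ ≤ P.trace.re ^ a * Q.trace.re ^ b := by
  have eP : P.trace.re = ∑ i, hP.isHermitian.eigenvalues i := by
    rw [hP.isHermitian.trace_eq_sum_eigenvalues]
    simp
  have eQ : Q.trace.re = ∑ i, hQ.isHermitian.eigenvalues i := by
    rw [hQ.isHermitian.trace_eq_sum_eigenvalues]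
    simp
  rw [eP, eQ, matPow, matPow, ← fcalc_ofReal hP.isHermitian, ← fcalc_ofReal hQ.isHermitian]
  exact norm_trace_diagonal_mul_le
    (norm_le_one_of_isometry (eigenvectorUnitary_conjTranspose_mul hP.isHermitian))
    (norm_le_one_of_isometry (eigenvectorUnitary_conjTranspose_mul hQ.isHermitian)) hC
    hP.eigenvalues_nonneg hQ.eigenvalues_nonneg ha hb hab

end Holder

/-! ### Polar decomposition and Hölder with a Schatten norm. -/

section Polar

open scoped Matrix.Norms.L2Operator

variable {k n : Type*} [Fintype k] [Fintype n] [DecidableEq n]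

/-- The partial isometry of the polar decomposition of `A`. -/
noncomputable def polarPart (A : Matrix k n ℂ) : Matrix k n ℂ := A * matPow (Aᴴ * A) (-(1 / 2))

/-- The zeroth power is the support projection of `A†A`, and `A†A` has the same kernel as `A`. -/
lemma mul_matPow_zero (A : Matrix k n ℂ) : A * matPow (Aᴴ * A) 0 = A := by
  have hA := posSemidef_conjTranspose_mul_self A
  have h : A * (1 - matPow (Aᴴ * A) 0) = 0 := by
    rw [← conjTranspose_mul_self_eq_zero, conjTranspose_mul]
    have : Aᴴ * A * matPow (Aᴴ * A) 0 = Aᴴ * A := by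
      conv_lhs => rw [← matPow_one hA, matPow_matPow hA, mul_zero, ← matPow_add hA, add_zero]
      exact matPow_one hA
    rw [Matrix.mul_assoc, ← Matrix.mul_assoc Aᴴ, Matrix.mul_sub, this, Matrix.mul_one, sub_self,
      Matrix.mul_zero]
  rwa [Matrix.mul_sub, Matrix.mul_one, sub_eq_zero, eq_comm] at h

lemma polarPart_mul_matPow (A : Matrix k n ℂ) : polarPart A * matPow (Aᴴ * A) (1 / 2) = A := by
  have hA := posSemidef_conjTranspose_mul_self A
  rw [polarPart, Matrix.mul_assoc, ← matPow_add hA]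
  norm_num [mul_matPow_zero]

lemma conjTranspose_polarPart_mul (A : Matrix k n ℂ) :
    (polarPart A)ᴴ * A = matPow (Aᴴ * A) (1 / 2) := by
  have hA := posSemidef_conjTranspose_mul_self A
  rw [polarPart, conjTranspose_mul, (matPow_isHermitian _ _).eq, Matrix.mul_assoc]
  conv_lhs => rw [← matPow_one hA, matPow_matPow hA, ← matPow_add hA]
  norm_num

lemma norm_matPow_zero_le_one {B : Matrix n n ℂ} (hB : B.PosSemidef) : ‖matPow B 0‖ ≤ 1 := by
  refine norm_le_one_of_isProj ?_
  rw [(matPow_isHermitian _ _).eq, ← matPow_add hB, add_zero]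

lemma norm_polarPart_le_one (A : Matrix k n ℂ) : ‖polarPart A‖ ≤ 1 := by
  have hA := posSemidef_conjTranspose_mul_self A
  refine norm_le_one_of_conjTranspose_mul_self ?_
  have : (polarPart A)ᴴ * polarPart A = matPow (Aᴴ * A) 0 := by
    conv_lhs => rw [show polarPart A = A * matPow (Aᴴ * A) (-(1 / 2)) from rfl]
    rw [← Matrix.mul_assoc, ← polarPart, conjTranspose_polarPart_mul, ← matPow_add hA]
    norm_num
  rw [this]
  exact norm_matPow_zero_le_one hA

end Polar

section Schatten

open scoped Matrix.Norms.L2Operator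

variable {k n : Type*} [Fintype k] [Fintype n] [DecidableEq n]

lemma schattenNorm_eq (A : Matrix k n ℂ) {p : ℝ≥0∞} (hp : p ≠ ⊤) :
    schattenNorm p A = (matPow (Aᴴ * A) (p.toReal / 2)).trace.re ^ (1 / p.toReal) := by
  rw [schattenNorm, if_neg hp, matAbs, matPow_matPow (posSemidef_conjTranspose_mul_self A)]
  ring_nf

/-- The Hölder inequality for the trace, with the Schatten norm of one factor. -/
theorem norm_trace_mul_le_schattenNorm [DecidableEq k] {P : Matrix n n ℂ}
    (hP : P.PosSemidef) {K : Matrix n k ℂ} (hK : ‖K‖ ≤ 1) (G : Matrix k n ℂ) {p : ℝ≥0∞}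
    (hp : 1 ≤ p) {a : ℝ} (hap : a = 1 - 1 / p.toReal) :
    ‖(matPow P a * K * G).trace‖ ≤ P.trace.re ^ a * schattenNorm p G := by
  by_cases hpt : p = ⊤
  -- `⊤.toReal = 0` and `1 / 0 = 0`, so the formula for `a` gives the correct conjugate exponent at
  -- `p = ∞`.
  · have ha1 : a = 1 := by simp [hap, hpt]
    rw [schattenNorm, if_pos hpt, ha1]
    rcases (norm_nonneg G).eq_or_lt with h | h
    · have : G = 0 := norm_eq_zero.1 h.symm
      simp [this]
    · have hC : ‖K * (((‖G‖⁻¹ : ℝ) : ℂ) • G)‖ ≤ 1 := by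
        refine norm_mul_le_one hK ?_
        rw [norm_smul, Complex.norm_real, norm_inv, norm_norm, inv_mul_cancel₀ h.ne']
      -- With `Q = 1` and `b = 0` the second trace factor becomes one; `G` scaled by its norm goes
      -- into the contraction.
      have h1 := norm_trace_matPow_mul_le hP (PosSemidef.one (n := n)) hC (a := 1) (b := 0)
        zero_le_one le_rfl (by norm_num)
      have h2 : matPow (1 : Matrix n n ℂ) 0 = 1 := by
        have := mul_matPow_zero (1 : Matrix n n ℂ)
        simpa using this
      rw [h2, Matrix.mul_one, Matrix.mul_smul, Matrix.mul_smul, trace_smul, norm_smul,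
        Complex.norm_real, norm_inv, norm_norm, Real.rpow_zero, mul_one,
        inv_mul_le_iff₀ h, ← Matrix.mul_assoc, mul_comm] at h1
      exact h1
  · have hp1 : 1 ≤ p.toReal := by
      simpa using ENNReal.toReal_mono hpt hp
    have hG := posSemidef_conjTranspose_mul_self G
    have hb : 0 ≤ 1 / p.toReal := by positivity
    have hb1 : 1 / p.toReal ≤ 1 := by rw [div_le_one (by linarith)]; exact hp1
    -- Here `Q = |G|^p`, so `Q^{1/p} = |G|`; the polar part of `G` joins the contraction `K`.
    have h1 := norm_trace_matPow_mul_le hP (matPow_posSemidef hG (p.toReal / 2))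
      (norm_mul_le_one hK (norm_polarPart_le_one G)) (a := a) (b := 1 / p.toReal)
      (by linarith) hb (by linarith)
    have h2 : p.toReal / 2 * (1 / p.toReal) = 1 / 2 := by field_simp
    rw [matPow_matPow hG, h2, Matrix.mul_assoc, Matrix.mul_assoc, polarPart_mul_matPow,
      ← Matrix.mul_assoc, ← schattenNorm_eq G hpt] at h1
    exact h1

end Schatten

/-! ### Entire functions and matrices bounded on the strip containing all values of `α'`. -/

section Tame

/-- An entire function that is bounded on the strip `|Re z| ≤ 1`. -/
def IsTame (f : ℂ → ℂ) : Prop :=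
  Differentiable ℂ f ∧ ∃ C, ∀ z : ℂ, |z.re| ≤ 1 → ‖f z‖ ≤ C

lemma IsTame.const (c : ℂ) : IsTame fun _ => c := ⟨differentiable_const c, ‖c‖, fun _ _ => le_rfl⟩

lemma IsTame.mul {f g : ℂ → ℂ} (hf : IsTame f) (hg : IsTame g) : IsTame fun z => f z * g z := by
  obtain ⟨C, hC⟩ := hf.2
  obtain ⟨D, hD⟩ := hg.2
  refine ⟨hf.1.mul hg.1, C * D, fun z hz => ?_⟩
  rw [norm_mul]
  exact mul_le_mul (hC z hz) (hD z hz) (norm_nonneg _) ((norm_nonneg _).trans (hC z hz))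

lemma IsTame.sum {ι : Type*} {s : Finset ι} {f : ι → ℂ → ℂ} (hf : ∀ i ∈ s, IsTame (f i)) :
    IsTame fun z => ∑ i ∈ s, f i z := by
  refine ⟨Differentiable.fun_sum fun i hi => (hf i hi).1, ?_⟩
  have h : ∀ i, ∃ C, i ∈ s → ∀ z : ℂ, |z.re| ≤ 1 → ‖f i z‖ ≤ C := fun i => by
    by_cases hi : i ∈ s
    · obtain ⟨C, hC⟩ := (hf i hi).2
      exact ⟨C, fun _ => hC⟩
    · exact ⟨0, fun h => absurd h hi⟩
  choose C hC using h
  exact ⟨∑ i ∈ s, C i, fun z hz => norm_sum_le_of_le s fun i hi => hC i hi z hz⟩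

/-- For `x > 0` the modulus of `x ^ w` depends only on `Re w`, which stays bounded on the strip. -/
lemma isTame_cpow {x : ℝ} (hx : 0 ≤ x) (c d : ℝ) :
    IsTame fun z => if x = 0 then 0 else (x : ℂ) ^ ((c : ℂ) + d * z) := by
  by_cases h : x = 0
  · simpa [h] using IsTame.const 0
  have hpos : 0 < x := lt_of_le_of_ne hx (Ne.symm h)
  simp only [if_neg h]
  refine ⟨?_, Real.exp (|Real.log x| * (|c| + |d|)), fun z hz => ?_⟩
  · refine Differentiable.const_cpow (by fun_prop) (Or.inl ?_)
    exact_mod_cast h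
  · rw [norm_cpow_eq_rpow_re_of_pos hpos, Real.rpow_def_of_pos hpos]
    refine Real.exp_le_exp.2 ((le_abs_self _).trans ?_)
    rw [abs_mul]
    refine mul_le_mul_of_nonneg_left ?_ (abs_nonneg _)
    have : ((c : ℂ) + d * z).re = c + d * z.re := by simp
    rw [this]
    refine (abs_add_le _ _).trans (add_le_add le_rfl ?_)
    rw [abs_mul]
    exact mul_le_of_le_one_right (abs_nonneg _) hz

/-- A matrix-valued function with tame entries. -/
def IsTameMatrix {k n : Type*} (F : ℂ → Matrix k n ℂ) : Prop := ∀ i j, IsTame fun z => F z i j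

variable {k l n : Type*} [Fintype l]

lemma IsTameMatrix.const (A : Matrix k n ℂ) : IsTameMatrix fun _ => A := fun _ _ => IsTame.const _

lemma IsTameMatrix.mul {F : ℂ → Matrix k l ℂ} {G : ℂ → Matrix l n ℂ} (hF : IsTameMatrix F)
    (hG : IsTameMatrix G) : IsTameMatrix fun z => F z * G z := fun i j => by
  simp only [Matrix.mul_apply]
  exact IsTame.sum fun a _ => (hF i a).mul (hG a j)

lemma IsTameMatrix.kronecker {k' n' : Type*} {F : ℂ → Matrix k n ℂ} {G : ℂ → Matrix k' n' ℂ}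
    (hF : IsTameMatrix F) (hG : IsTameMatrix G) : IsTameMatrix fun z => F z ⊗ₖ G z :=
  fun i j => by
    exact (hF _ _).mul (hG _ _)

lemma IsTameMatrix.trace {F : ℂ → Matrix l l ℂ} (hF : IsTameMatrix F) :
    IsTame fun z => (F z).trace := IsTame.sum fun i _ => hF i i

lemma isTameMatrix_matCpow [DecidableEq l] {A : Matrix l l ℂ} (hA : A.PosSemidef) (c d : ℝ) :
    IsTameMatrix fun z => matCpow hA.isHermitian (c + d * z) := by
  refine ((IsTameMatrix.const _).mul fun i j => ?_).mul (IsTameMatrix.const _)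
  by_cases h : i = j
  · subst h
    simpa using isTame_cpow (hA.eigenvalues_nonneg i) c d
  · simpa [Matrix.diagonal_apply_ne _ h] using IsTame.const 0

end Tame

/-! ### Complex interpolation of Schatten norms. -/

section Interpolation

open scoped Matrix.Norms.L2Operator

variable {k n : Type*} [Fintype k] [Fintype n] [DecidableEq n]

/-- The three lines theorem for tame functions. -/
lemma IsTame.norm_le_interp {f : ℂ → ℂ} (hf : IsTame f) {s t r : ℝ} (hs : -1 ≤ s) (hsr : s < r)
    (hrt : r < t) (ht : t ≤ 1) {a b : ℝ} (ha : ∀ z : ℂ, z.re = s → ‖f z‖ ≤ a)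
    (hb : ∀ z : ℂ, z.re = t → ‖f z‖ ≤ b) :
    ‖f r‖ ≤ a ^ (1 - (r - s) / (t - s)) * b ^ ((r - s) / (t - s)) := by
  obtain ⟨C, hC⟩ := hf.2
  have h := HadamardThreeLines.norm_le_interp_of_mem_verticalClosedStrip' (f := f)
    (z := (r : ℂ)) (l := s) (u := t) (hsr.trans hrt) ⟨hsr.le, hrt.le⟩ hf.1.diffContOnCl ?_
    (fun z hz => ha z hz) (fun z hz => hb z hz)
  · simpa using h
  · refine ⟨C, ?_⟩
    rintro _ ⟨z, hz, rfl⟩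
    exact hC z (abs_le.2 ⟨hs.trans hz.1, hz.2.trans ht⟩)

/-- The bound `‖F z‖ₚ ≤ M` with `p = 2 / (1 - x)`, for `z` on the line `Re z = x`, in dual form. -/
def DualBound [DecidableEq k] (F : ℂ → Matrix k n ℂ) (x M : ℝ) : Prop :=
  ∀ P : Matrix n n ℂ, P.PosSemidef → ∀ K : Matrix n k ℂ, ‖K‖ ≤ 1 → ∀ z : ℂ, z.re = x →
    ‖(matPow P ((1 + x) / 2) * K * F z).trace‖ ≤ P.trace.re ^ ((1 + x) / 2) * M

/-- Complex interpolation for Schatten norms. -/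
theorem schattenNorm_le_interp [DecidableEq k] {F : ℂ → Matrix k n ℂ} (hF : IsTameMatrix F)
    {s t r : ℝ} (hs : -1 ≤ s) (hsr : s < r) (hrt : r < t) (ht : t ≤ 1) {a b : ℝ} (ha0 : 0 ≤ a)
    (hb0 : 0 ≤ b) (ha : DualBound F s a) (hb : DualBound F t b) {p : ℝ≥0∞} (hp : p ≠ ⊤)
    (hpr : p.toReal = 2 / (1 - r)) :
    schattenNorm p (F r) ≤ a ^ (1 - (r - s) / (t - s)) * b ^ ((r - s) / (t - s)) := by
  have hr1 : 0 < 1 - r := by linarith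
  have hT := posSemidef_conjTranspose_mul_self (F r)
  set T := (F r)ᴴ * F r with hTdef
  have hP := matPow_posSemidef hT (p.toReal / 2)
  rw [schattenNorm_eq _ hp, ← hTdef]
  set P := matPow T (p.toReal / 2) with hPdef
  set S := P.trace.re with hS
  have hS0 : 0 ≤ S := trace_re_nonneg hP
  have hp1 : 1 / p.toReal = (1 - r) / 2 := by rw [hpr]; field_simp
  rw [hp1]
  rcases hS0.eq_or_lt with h | hSpos
  · rw [← h, Real.zero_rpow (by linarith)]
    positivity
  set K := (polarPart (F r))ᴴ with hK
  have hKn : ‖K‖ ≤ 1 := by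
    rw [hK, l2_opNorm_conjTranspose]
    exact norm_polarPart_le_one _
  -- The dual test function with `P = |F r|^p` and `K` the adjoint polar part: Hölder is saturated
  -- at `z = r`, where its value is `Tr |F r|^p = S`. Elsewhere the imaginary power of `P` is a
  -- unitary absorbed into `K`.
  set h : ℂ → ℂ := fun z =>
    (matCpow hP.isHermitian (((1 / 2 : ℝ) : ℂ) + ((1 / 2 : ℝ) : ℂ) * z) * K * F z).trace with hh
  have htame : IsTame h :=
    (((isTameMatrix_matCpow hP _ _).mul (IsTameMatrix.const K)).mul hF).trace
  have hline : ∀ x M : ℝ, DualBound F x M → ∀ z : ℂ, z.re = x → ‖h z‖ ≤ S ^ ((1 + x) / 2) * M := by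
    intro x M hM z hz
    have e : (((1 / 2 : ℝ) : ℂ) + ((1 / 2 : ℝ) : ℂ) * z).re = (1 + x) / 2 := by
      rw [add_re, re_ofReal_mul, ofReal_re, hz]
      ring
    simp only [hh]
    rw [matCpow_eq_mul_matPhase hP, e, Matrix.mul_assoc (matPow P _)]
    exact hM P hP _ (norm_mul_le_one
      (norm_le_one_of_isometry (matPhase_conjTranspose_mul _ _)) hKn) z hz
  have hint := htame.norm_le_interp hs hsr hrt ht (hline s a ha) (hline t b hb)
  have hval : h r = (S : ℂ) := by
    have e : ((1 / 2 : ℝ) : ℂ) + ((1 / 2 : ℝ) : ℂ) * (r : ℂ) = (((1 + r) / 2 : ℝ) : ℂ) := by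
      push_cast
      ring
    have e2 : p.toReal / 2 * ((1 + r) / 2) + 1 / 2 = p.toReal / 2 := by
      rw [hpr]
      field_simp
      ring
    simp only [hh]
    rw [e, ← matPow_eq_matCpow hP, Matrix.mul_assoc, hK, conjTranspose_polarPart_mul, ← hTdef,
      hPdef, matPow_matPow hT, ← matPow_add hT, e2, ← hPdef, trace_posSemidef_eq hP]
  rw [hval, Complex.norm_real, Real.norm_of_nonneg hS0] at hint
  set c := (r - s) / (t - s) with hc
  have hts : 0 < t - s := by linarith
  -- The exponent `(1 + x) / 2` is affine in `x`, so the powers of `S` interpolate exactly.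
  have e3 : (S ^ ((1 + s) / 2) * a) ^ (1 - c) * (S ^ ((1 + t) / 2) * b) ^ c =
      S ^ ((1 + r) / 2) * (a ^ (1 - c) * b ^ c) := by
    rw [Real.mul_rpow (Real.rpow_nonneg hS0 _) ha0, Real.mul_rpow (Real.rpow_nonneg hS0 _) hb0,
      ← Real.rpow_mul hS0, ← Real.rpow_mul hS0]
    have : (1 + r) / 2 = (1 + s) / 2 * (1 - c) + (1 + t) / 2 * c := by
      rw [hc]
      field_simp
      ring
    rw [this, Real.rpow_add hSpos]
    ring
  rw [e3] at hint
  have hSr : 0 < S ^ ((1 + r) / 2) := Real.rpow_pos_of_pos hSpos _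
  -- Dividing `S` by `S^{(1+r)/2}` leaves `S^{(1-r)/2} = S^{1/p}`, the Schatten norm.
  refine le_of_mul_le_mul_left ?_ hSr
  rw [← Real.rpow_add hSpos]
  calc S ^ ((1 + r) / 2 + (1 - r) / 2) = S := by
        rw [show (1 + r) / 2 + (1 - r) / 2 = 1 by ring, Real.rpow_one]
    _ ≤ _ := hint

end Interpolation

/-! ### Partial traces, supports and contractions. -/

section PartialTrace

variable {n k e : Type*} [Fintype n] [Fintype k] [Fintype e]

lemma partialTrace_mul_conjTranspose_posSemidef (Y : Matrix (k × e) n ℂ) :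
    (partialTrace (Y * Yᴴ)).PosSemidef := by
  have h : partialTrace (Y * Yᴴ) =
      ∑ a, (Matrix.of fun i j => Y (i, a) j) *
        (Matrix.of fun i j => Y (i, a) j : Matrix k n ℂ)ᴴ := by
    ext i j
    simp [partialTrace, Matrix.mul_apply, Matrix.sum_apply]
  rw [h]
  exact posSemidef_sum _ fun a _ => posSemidef_self_mul_conjTranspose _

lemma trace_kronecker_one_mul [DecidableEq e] (B : Matrix k k ℂ) (M : Matrix (k × e) (k × e) ℂ) :
    ((B ⊗ₖ (1 : Matrix e e ℂ)) * M).trace = (B * partialTrace M).trace := by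
  simp only [Matrix.trace, Matrix.diag, Matrix.mul_apply, partialTrace, Matrix.of_apply,
    kroneckerMap_apply, Fintype.sum_prod_type, Matrix.one_apply, Finset.mul_sum]
  refine Finset.sum_congr rfl fun i _ => ?_
  rw [Finset.sum_comm]
  refine Finset.sum_congr rfl fun j _ => Finset.sum_congr rfl fun a _ => ?_
  simp

variable [DecidableEq k] [DecidableEq e]

/-- The operator `Y` maps into the support of `partialTrace (Y * Yᴴ)`. -/
lemma matPow_zero_kronecker_mul (Y : Matrix (k × e) n ℂ) :
    (matPow (partialTrace (Y * Yᴴ)) 0 ⊗ₖ (1 : Matrix e e ℂ)) * Y = Y := by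
  have hR := partialTrace_mul_conjTranspose_posSemidef Y
  set R := partialTrace (Y * Yᴴ) with hRdef
  set B : Matrix k k ℂ := 1 - matPow R 0 with hB
  have hBR : B * R = 0 := by
    have h : matPow R 0 * R = R := by
      conv_lhs => rw [← matPow_one hR, matPow_matPow hR, mul_zero, ← matPow_add hR, zero_add]
      exact matPow_one hR
    rw [hB, Matrix.sub_mul, Matrix.one_mul, h, sub_self]
  have hBB : Bᴴ * B = B := by
    have h : matPow R 0 * matPow R 0 = matPow R 0 := by rw [← matPow_add hR, add_zero]
    rw [hB, conjTranspose_sub, conjTranspose_one, (matPow_isHermitian _ _).eq, Matrix.sub_mul,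
      Matrix.one_mul, Matrix.mul_sub, Matrix.mul_one, h, sub_self, sub_zero]
  -- Its squared Hilbert–Schmidt norm is `Tr(B R)`, and the projection `B` annihilates `R`.
  have h0 : (B ⊗ₖ (1 : Matrix e e ℂ)) * Y = 0 := by
    rw [← trace_conjTranspose_mul_self_eq_zero_iff, conjTranspose_mul, Matrix.mul_assoc,
      ← Matrix.mul_assoc _ _ Y, conjTranspose_kronecker, conjTranspose_one, ← mul_kronecker_mul,
      hBB, Matrix.one_mul, Matrix.trace_mul_comm, Matrix.mul_assoc, trace_kronecker_one_mul,
      ← hRdef, hBR, trace_zero]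
  have h1 : B ⊗ₖ (1 : Matrix e e ℂ) + matPow R 0 ⊗ₖ (1 : Matrix e e ℂ) = 1 := by
    rw [← add_kronecker, hB, sub_add_cancel, one_kronecker_one]
  calc _ = (B ⊗ₖ (1 : Matrix e e ℂ) + matPow R 0 ⊗ₖ (1 : Matrix e e ℂ)) * Y := by
        rw [Matrix.add_mul, h0, zero_add]
    _ = Y := by rw [h1, Matrix.one_mul]

end PartialTrace

section Support

variable {n : Type*} [Fintype n] [DecidableEq n]

lemma exists_eq_mul_of_supp_le {ρ σ : Matrix n n ℂ} (h : supp ρ ≤ supp σ) : ∃ B, ρ = σ * B := by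
  have hj : ∀ j, ∃ v, σ *ᵥ v = ρ *ᵥ Pi.single j 1 := fun j =>
    h ⟨Pi.single j 1, rfl⟩
  choose v hv using hj
  refine ⟨Matrix.of fun i j => v j i, ?_⟩
  ext i j
  have := congrFun (hv j) i
  rw [mulVec_single_one] at this
  rw [← show (ρ.col j) i = ρ i j from rfl, ← this]
  rfl

end Support

section NormBounds

open scoped Matrix.Norms.L2Operator

variable {k e : Type*} [Fintype k] [DecidableEq k] [Fintype e] [DecidableEq e]

lemma norm_kronecker_one_le_one_of_isometry {A : Matrix k k ℂ} (hA : Aᴴ * A = 1) :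
    ‖A ⊗ₖ (1 : Matrix e e ℂ)‖ ≤ 1 := by
  refine norm_le_one_of_isometry ?_
  rw [conjTranspose_kronecker, conjTranspose_one, ← mul_kronecker_mul, hA, Matrix.one_mul,
    one_kronecker_one]

lemma norm_matPow_zero_kronecker_one_le_one {A : Matrix k k ℂ} (hA : A.PosSemidef) :
    ‖matPow A 0 ⊗ₖ (1 : Matrix e e ℂ)‖ ≤ 1 := by
  refine norm_le_one_of_isProj ?_
  rw [conjTranspose_kronecker, conjTranspose_one, ← mul_kronecker_mul, Matrix.one_mul,
    (matPow_isHermitian _ _).eq, ← matPow_add hA, add_zero]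

end NormBounds

/-! ### The analytic chain and its bounds on vertical lines. -/

section Chain

variable {n k e : Type*} [Fintype n] [DecidableEq n] [Fintype k] [DecidableEq k]
  [Fintype e] [DecidableEq e]

/-- The operator of `swiveledChain` with real parameter `x`. -/
noncomputable def realChain (ρ σ : Matrix n n ℂ) (R S : Matrix k k ℂ) (U : Matrix (k × e) n ℂ)
    (x : ℝ) (V : Matrix n n ℂ) (W : Matrix k k ℂ) : Matrix (k × e) n ℂ :=
  ((matPow R (-x / 2) * W * matPow S (x / 2)) ⊗ₖ (1 : Matrix e e ℂ)) * U *
    matPow σ (-x / 2) * V * matPow ρ (1 / 2)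

/-- The operator of `swiveledChain` with complex parameter `z`. -/
noncomputable def complexChain (ρ : Matrix n n ℂ) {σ : Matrix n n ℂ} {R S : Matrix k k ℂ}
    (hσ : σ.PosSemidef) (hR : R.PosSemidef) (hS : S.PosSemidef) (U : Matrix (k × e) n ℂ)
    (V : Matrix n n ℂ) (W : Matrix k k ℂ) (z : ℂ) : Matrix (k × e) n ℂ :=
  ((matCpow hR.isHermitian ((0 : ℝ) + (-1 / 2 : ℝ) * z) * W *
    matCpow hS.isHermitian ((0 : ℝ) + (1 / 2 : ℝ) * z)) ⊗ₖ (1 : Matrix e e ℂ)) * U *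
    matCpow hσ.isHermitian ((0 : ℝ) + (-1 / 2 : ℝ) * z) * V * matPow ρ (1 / 2)

variable {ρ σ : Matrix n n ℂ} {R S : Matrix k k ℂ} (hσ : σ.PosSemidef) (hR : R.PosSemidef)
  (hS : S.PosSemidef) (U : Matrix (k × e) n ℂ) (V : Matrix n n ℂ) (W : Matrix k k ℂ)

lemma isTameMatrix_complexChain : IsTameMatrix (complexChain ρ hσ hR hS U V W) := by
  unfold complexChain
  exact ((((((isTameMatrix_matCpow hR _ _).mul (.const W)).mul
    (isTameMatrix_matCpow hS _ _)).kronecker (.const 1)).mul (.const U)).mul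
    (isTameMatrix_matCpow hσ _ _)).mul (.const V) |>.mul (.const _)

lemma complexChain_ofReal (x : ℝ) :
    complexChain ρ hσ hR hS U V W x = realChain ρ σ R S U x V W := by
  have e1 : ((0 : ℝ) : ℂ) + ((-1 / 2 : ℝ) : ℂ) * (x : ℂ) = ((-x / 2 : ℝ) : ℂ) := by
    push_cast
    ring
  have e2 : ((0 : ℝ) : ℂ) + ((1 / 2 : ℝ) : ℂ) * (x : ℂ) = ((x / 2 : ℝ) : ℂ) := by
    push_cast
    ring
  rw [complexChain, e1, e2, ← matPow_eq_matCpow hR, ← matPow_eq_matCpow hS, ← matPow_eq_matCpow hσ,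
    realChain]

/-- Imaginary powers are absorbed into the swivels, up to an isometry on the left. -/
lemma complexChain_eq (z : ℂ) :
    complexChain ρ hσ hR hS U V W z =
      (matPhase hR.isHermitian (-z.im / 2) ⊗ₖ (1 : Matrix e e ℂ)) *
        realChain ρ σ R S U z.re (matPhase hσ.isHermitian (-z.im / 2) * V)
          (W * matPhase hS.isHermitian (z.im / 2)) := by
  have r1 : (((0 : ℝ) : ℂ) + ((-1 / 2 : ℝ) : ℂ) * z).re = -z.re / 2 := by
    rw [add_re, re_ofReal_mul, ofReal_re]
    ring
  have i1 : (((0 : ℝ) : ℂ) + ((-1 / 2 : ℝ) : ℂ) * z).im = -z.im / 2 := by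
    rw [add_im, im_ofReal_mul, ofReal_im]
    ring
  have r2 : (((0 : ℝ) : ℂ) + ((1 / 2 : ℝ) : ℂ) * z).re = z.re / 2 := by
    rw [add_re, re_ofReal_mul, ofReal_re]
    ring
  have i2 : (((0 : ℝ) : ℂ) + ((1 / 2 : ℝ) : ℂ) * z).im = z.im / 2 := by
    rw [add_im, im_ofReal_mul, ofReal_im]
    ring
  -- Each phase is pulled out on the side where it is needed: those of `S` and `σ` next to `W` and
  -- `V`, that of `R` to the far left.
  rw [complexChain, matCpow_eq_matPhase_mul hR, matCpow_eq_matPhase_mul hS,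
    matCpow_eq_mul_matPhase hσ, r1, i1, r2, i2, realChain]
  simp only [← Matrix.mul_assoc, ← mul_kronecker_mul, Matrix.one_mul]

open scoped Matrix.Norms.L2Operator

/-- The phases vary with `z`, so a bound for one pair of swivels would not do: `hM` must be uniform.
The leftover unitary on the left is absorbed into `K`. -/
lemma dualBound_complexChain {p : ℝ≥0∞} (hp : 1 ≤ p) {x M : ℝ}
    (hx : (1 + x) / 2 = 1 - 1 / p.toReal)
    (hM : ∀ V ∈ swivels σ, ∀ W ∈ swivels S, schattenNorm p (realChain ρ σ R S U x V W) ≤ M)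
    (hV : V ∈ swivels σ) (hW : W ∈ swivels S) :
    DualBound (complexChain ρ hσ hR hS U V W) x M := by
  rintro P hP K hK z rfl
  rw [complexChain_eq, ← Matrix.mul_assoc, Matrix.mul_assoc (matPow P _)]
  refine (norm_trace_mul_le_schattenNorm hP (norm_mul_le_one hK
    (norm_kronecker_one_le_one_of_isometry (matPhase_conjTranspose_mul _ _))) _ hp hx).trans ?_
  exact mul_le_mul_of_nonneg_left (hM _ (mul_swivels (matPhase_mem_swivels _ _) hV) _
    (mul_swivels hW (matPhase_mem_swivels _ _))) (Real.rpow_nonneg (trace_re_nonneg hP) _)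

/-- At `Re z = 0` the real powers are support projections, so all factors left of `ρ^{1/2}` form a
contraction. Hölder with exponents `1/2`, `1/2` and `Tr ρ = 1` gives the constant `1`. -/
lemma dualBound_complexChain_zero (hρ : IsDensity ρ) (hU : Uᴴ * U = 1)
    (hV : V ∈ swivels σ) (hW : W ∈ swivels S) :
    DualBound (complexChain ρ hσ hR hS U V W) 0 1 := by
  rintro P hP K hK z hz
  rw [complexChain_eq, hz, realChain]
  have hV' : (matPhase hσ.isHermitian (-z.im / 2) * V)ᴴ * (matPhase hσ.isHermitian (-z.im / 2) * V)
      = 1 := mem_unitaryGroup_iff'.1 (mul_swivels (matPhase_mem_swivels _ _) hV).1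
  have hW' : (W * matPhase hS.isHermitian (z.im / 2))ᴴ * (W * matPhase hS.isHermitian (z.im / 2))
      = 1 := mem_unitaryGroup_iff'.1 (mul_swivels hW (matPhase_mem_swivels _ _)).1
  set V' := matPhase hσ.isHermitian (-z.im / 2) * V
  set W' := W * matPhase hS.isHermitian (z.im / 2)
  set Z := matPhase hR.isHermitian (-z.im / 2)
  have hC : ‖K * ((Z ⊗ₖ (1 : Matrix e e ℂ)) *
      (((matPow R 0 * W' * matPow S 0) ⊗ₖ (1 : Matrix e e ℂ)) * U * matPow σ 0 * V'))‖ ≤ 1 := by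
    have e1 : (matPow R 0 * W' * matPow S 0) ⊗ₖ (1 : Matrix e e ℂ) =
        (matPow R 0 ⊗ₖ (1 : Matrix e e ℂ)) * (W' ⊗ₖ (1 : Matrix e e ℂ)) *
          (matPow S 0 ⊗ₖ (1 : Matrix e e ℂ)) := by
      rw [← mul_kronecker_mul, ← mul_kronecker_mul, Matrix.one_mul, Matrix.one_mul]
    rw [e1]
    exact norm_mul_le_one hK (norm_mul_le_one
      (norm_kronecker_one_le_one_of_isometry (matPhase_conjTranspose_mul _ _))
      (norm_mul_le_one (norm_mul_le_one (norm_mul_le_one (norm_mul_le_one (norm_mul_le_one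
        (norm_matPow_zero_kronecker_one_le_one hR) (norm_kronecker_one_le_one_of_isometry hW'))
        (norm_matPow_zero_kronecker_one_le_one hS)) (norm_le_one_of_isometry hU))
        (norm_matPow_zero_le_one hσ)) (norm_le_one_of_isometry hV')))
  have h := norm_trace_matPow_mul_le hP hρ.1 hC (a := (1 + 0) / 2) (b := 1 / 2)
    (by norm_num) (by norm_num) (by norm_num)
  rw [hρ.2, one_re, Real.one_rpow] at h
  simpa only [neg_zero, zero_div, Matrix.mul_assoc] using h

end Chain

/-! ### The parameter `α'`: increasing, in `[-1, 1]`, zero at `α = 1`. -/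

section DualParam

variable {α γ : ℝ≥0∞}

lemma half_le_toReal (hα : 1 / 2 ≤ α) (h : α ≠ ⊤) : 1 / 2 ≤ α.toReal := by
  have := ENNReal.toReal_mono h hα
  simpa using this

lemma dualParam_eq (hα : 1 / 2 ≤ α) (h : α ≠ ⊤) : dualParam α = 1 - 1 / α.toReal := by
  have := half_le_toReal hα h
  rw [dualParam, if_neg h, sub_div, div_self (by linarith)]

lemma dualParam_lt (hα : 1 / 2 ≤ α) (hαγ : α < γ) : dualParam α < dualParam γ := by
  have hαt := hαγ.ne_top
  have h := half_le_toReal hα hαt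
  rw [dualParam_eq hα hαt]
  by_cases hγ : γ = ⊤
  · rw [dualParam, if_pos hγ]
    have : 0 < 1 / α.toReal := by positivity
    linarith
  · rw [dualParam_eq (hα.trans hαγ.le) hγ]
    have := one_div_lt_one_div_of_lt (by linarith) (ENNReal.toReal_strict_mono hγ hαγ)
    linarith

lemma dualParam_one : dualParam 1 = 0 := by simp [dualParam]

lemma dualParam_neg (hα : 1 / 2 ≤ α) (h : α < 1) : dualParam α < 0 :=
  dualParam_one ▸ dualParam_lt hα h

lemma dualParam_pos (h : 1 < α) : 0 < dualParam α :=
  dualParam_one ▸ dualParam_lt (by norm_num) h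

lemma neg_one_le_dualParam (hα : 1 / 2 ≤ α) : -1 ≤ dualParam α := by
  by_cases h : α = ⊤
  · rw [dualParam, if_pos h]
    norm_num
  · have h1 := half_le_toReal hα h
    have := one_div_le_one_div_of_le (by norm_num) h1
    rw [dualParam_eq hα h]
    norm_num at this ⊢
    linarith

lemma dualParam_le_one (hα : 1 / 2 ≤ α) : dualParam α ≤ 1 := by
  by_cases h : α = ⊤
  · rw [dualParam, if_pos h]
  · have h1 := half_le_toReal hα h
    have : 0 < 1 / α.toReal := by positivity
    rw [dualParam_eq hα h]
    linarith

lemma one_le_two_mul (hα : 1 / 2 ≤ α) : 1 ≤ 2 * α := by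
  calc (1 : ℝ≥0∞) = 2 * (1 / 2) := by
        rw [one_div, ENNReal.mul_inv_cancel two_ne_zero ENNReal.ofNat_ne_top]
    _ ≤ 2 * α := by gcongr

lemma two_mul_toReal (hα : 1 / 2 ≤ α) (h : α ≠ ⊤) : (2 * α).toReal = 2 / (1 - dualParam α) := by
  have h1 := half_le_toReal hα h
  rw [dualParam_eq hα h, ENNReal.toReal_mul]
  simp

lemma half_one_add_dualParam (hα : 1 / 2 ≤ α) :
    (1 + dualParam α) / 2 = 1 - 1 / (2 * α).toReal := by
  by_cases h : α = ⊤
  -- At `α = ∞` both sides equal one, again because `1 / ⊤.toReal = 0`.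
  · rw [dualParam, if_pos h, h]
    simp
  · have h1 := half_le_toReal hα h
    rw [dualParam_eq hα h, ENNReal.toReal_mul]
    have : α.toReal ≠ 0 := by positivity
    simp only [ENNReal.toReal_ofNat]
    field_simp
    ring

end DualParam

/-! ### The chain at `α' = 0` under the support condition. -/

section Support

variable {n k e : Type*} [Fintype n] [DecidableEq n] [Fintype k] [DecidableEq k]
  [Fintype e] [DecidableEq e] {ρ σ : Matrix n n ℂ}

lemma matPow_half_mul_self (hρ : ρ.PosSemidef) : matPow ρ (1 / 2) * matPow ρ (1 / 2) = ρ := by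
  rw [← matPow_add hρ, add_halves, matPow_one hρ]

lemma mul_conjTranspose_matPow_half {m : Type*} (hρ : ρ.PosSemidef) (U : Matrix m n ℂ) :
    U * matPow ρ (1 / 2) * (U * matPow ρ (1 / 2))ᴴ = U * ρ * Uᴴ := by
  rw [conjTranspose_mul, (matPow_isHermitian _ _).eq, Matrix.mul_assoc, ← Matrix.mul_assoc _ _ Uᴴ,
    matPow_half_mul_self hρ, Matrix.mul_assoc]

lemma partialTrace_conj_posSemidef {l m : Type*} [Fintype l] [Fintype m] (hρ : ρ.PosSemidef)
    (U : Matrix (l × m) n ℂ) :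
    (partialTrace (U * ρ * Uᴴ)).PosSemidef :=
  mul_conjTranspose_matPow_half hρ U ▸ partialTrace_mul_conjTranspose_posSemidef _

lemma mul_matPow_half_eq (hρ : ρ.PosSemidef) : ρ * matPow ρ (-(1 / 2)) = matPow ρ (1 / 2) := by
  conv_lhs => rw [← matPow_one hρ, matPow_matPow hρ, ← matPow_add hρ]
  norm_num

/-- Three support projections remain, each acting trivially: that of `σ` because `ρ` factors through
`σ`, that of `N(σ)` because `U ρ^{1/2}` factors through `U σ^{1/2}`, that of `N(ρ)` by
`matPow_zero_kronecker_mul`. -/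
lemma realChain_zero_of_supp_le (hρ : ρ.PosSemidef) (hσ : σ.PosSemidef) (h : supp ρ ≤ supp σ)
    (U : Matrix (k × e) n ℂ) :
    realChain ρ σ (partialTrace (U * ρ * Uᴴ)) (partialTrace (U * σ * Uᴴ)) U 0 1 1 =
      U * matPow ρ (1 / 2) := by
  obtain ⟨B, hB⟩ := exists_eq_mul_of_supp_le h
  have hσ0 : matPow σ 0 * σ = σ := by
    conv_lhs => rw [← matPow_one hσ, matPow_matPow hσ, mul_zero, ← matPow_add hσ, zero_add]
    exact matPow_one hσ
  have hfac : matPow ρ (1 / 2) = σ * (B * matPow ρ (-(1 / 2))) := by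
    rw [← Matrix.mul_assoc, ← hB, mul_matPow_half_eq hρ]
  have h1 : matPow σ 0 * matPow ρ (1 / 2) = matPow ρ (1 / 2) := by
    rw [hfac, ← Matrix.mul_assoc, hσ0]
  have h2 : (matPow (partialTrace (U * σ * Uᴴ)) 0 ⊗ₖ (1 : Matrix e e ℂ)) *
      (U * matPow ρ (1 / 2)) = U * matPow ρ (1 / 2) := by
    have h3 := matPow_zero_kronecker_mul (U * matPow σ (1 / 2))
    rw [mul_conjTranspose_matPow_half hσ] at h3
    have h4 : U * matPow ρ (1 / 2) =
        U * matPow σ (1 / 2) * (matPow σ (1 / 2) * (B * matPow ρ (-(1 / 2)))) := by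
      rw [Matrix.mul_assoc, ← Matrix.mul_assoc (matPow σ _) (matPow σ _),
        matPow_half_mul_self hσ, ← hfac]
    rw [h4, ← Matrix.mul_assoc (_ ⊗ₖ _), h3]
  have h5 := matPow_zero_kronecker_mul (U * matPow ρ (1 / 2))
  rw [mul_conjTranspose_matPow_half hρ] at h5
  have h6 : ∀ X Y : Matrix k k ℂ, (X * Y) ⊗ₖ (1 : Matrix e e ℂ) =
      (X ⊗ₖ (1 : Matrix e e ℂ)) * (Y ⊗ₖ (1 : Matrix e e ℂ)) := fun X Y => by
    rw [← mul_kronecker_mul, Matrix.one_mul]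
  rw [realChain, neg_zero, zero_div, Matrix.mul_one, Matrix.mul_one, h6]
  generalize partialTrace (U * ρ * Uᴴ) = R at h5 ⊢
  generalize partialTrace (U * σ * Uᴴ) = S at h2 ⊢
  simp only [Matrix.mul_assoc]
  rw [h1, h2, h5]

lemma schattenNorm_two_isometry_mul {m : Type*} [Fintype m] (hρ : IsDensity ρ) {U : Matrix m n ℂ}
    (hU : Uᴴ * U = 1) : schattenNorm 2 (U * matPow ρ (1 / 2)) = 1 := by
  have h : (U * matPow ρ (1 / 2))ᴴ * (U * matPow ρ (1 / 2)) = ρ := by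
    rw [conjTranspose_mul, (matPow_isHermitian _ _).eq, Matrix.mul_assoc, ← Matrix.mul_assoc Uᴴ,
      hU, Matrix.one_mul, matPow_half_mul_self hρ.1]
  rw [schattenNorm_eq _ ENNReal.ofNat_ne_top, h]
  norm_num [matPow_one hρ.1, hρ.2]

end Support

/-! ### Suprema over the swivels and the three cases of monotonicity. -/

section LogNorm

variable {n k e : Type*} [Fintype n] [DecidableEq n] [Fintype k] [DecidableEq k]
  [Fintype e] [DecidableEq e]

/-- The maximum over the swivels of the logarithm of the Schatten norm. -/
noncomputable def logNorm (ρ σ : Matrix n n ℂ) (Φ : Matrix n n ℂ →ₗ[ℂ] Matrix k k ℂ)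
    (U : Matrix (k × e) n ℂ) (α : ℝ≥0∞) : EReal :=
  ⨆ V ∈ swivels σ, ⨆ W ∈ swivels (Φ σ),
    ENNReal.log (ENNReal.ofReal (schattenNorm (2 * α) (swiveledChain ρ σ Φ U α V W)))

variable {ρ σ : Matrix n n ℂ} {Φ : Matrix n n ℂ →ₗ[ℂ] Matrix k k ℂ} {U : Matrix (k × e) n ℂ}
  {α γ : ℝ≥0∞}

lemma schattenNorm_le_exp_logNorm (h : logNorm ρ σ Φ U α ≠ ⊤) {V : Matrix n n ℂ}
    (hV : V ∈ swivels σ) {W : Matrix k k ℂ} (hW : W ∈ swivels (Φ σ)) :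
    schattenNorm (2 * α) (swiveledChain ρ σ Φ U α V W) ≤ (logNorm ρ σ Φ U α).exp.toReal := by
  have h1 : ENNReal.log (ENNReal.ofReal (schattenNorm (2 * α) (swiveledChain ρ σ Φ U α V W))) ≤
      logNorm ρ σ Φ U α :=
    le_iSup₂_of_le V hV (le_iSup₂_of_le W hW le_rfl)
  rw [← EReal.log_exp (logNorm ρ σ Φ U α), ENNReal.log_le_log_iff] at h1
  refine (ENNReal.ofReal_le_iff_le_toReal ?_).1 h1
  rwa [ne_eq, ← ENNReal.log_eq_top_iff, EReal.log_exp]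

/-- Exponentiating turns `-∞` into the real bound `0`, so only the value `⊤` has to be excluded;
attainment of the supremum plays no role. -/
lemma logNorm_le_mul {c : ℝ} (hc : 0 ≤ c) (h : logNorm ρ σ Φ U α ≠ ⊤)
    (hle : ∀ V ∈ swivels σ, ∀ W ∈ swivels (Φ σ),
      schattenNorm (2 * γ) (swiveledChain ρ σ Φ U γ V W) ≤ (logNorm ρ σ Φ U α).exp.toReal ^ c) :
    logNorm ρ σ Φ U γ ≤ c * logNorm ρ σ Φ U α := by
  have ht : (logNorm ρ σ Φ U α).exp ≠ ⊤ := by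
    rwa [ne_eq, ← ENNReal.log_eq_top_iff, EReal.log_exp]
  refine iSup₂_le fun V hV => iSup₂_le fun W hW => ?_
  calc _ ≤ ENNReal.log (ENNReal.ofReal ((logNorm ρ σ Φ U α).exp.toReal ^ c)) :=
        ENNReal.log_le_log (ENNReal.ofReal_le_ofReal (hle V hV W hW))
    _ = _ := by
        rw [← ENNReal.ofReal_rpow_of_nonneg ENNReal.toReal_nonneg hc, ENNReal.ofReal_toReal ht,
          ENNReal.log_rpow, EReal.log_exp]

lemma sandwichedDelta_eq :
    sandwichedDelta ρ σ Φ U α = ((2 / dualParam α : ℝ) : EReal) * logNorm ρ σ Φ U α := rfl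

lemma sandwichedDelta_le_of_one_lt (hρ : IsDensity ρ) (hσ : σ.PosSemidef)
    (hU : IsIsometricExtension Φ U) (hα : 1 < α) (hαγ : α < γ) :
    sandwichedDelta ρ σ Φ U α ≤ sandwichedDelta ρ σ Φ U γ := by
  have hα2 : 1 / 2 ≤ α := le_trans (by norm_num) hα.le
  have hγ2 := hα2.trans hαγ.le
  have hx := dualParam_pos hα
  have hxy := dualParam_lt hα2 hαγ
  have hy := hx.trans hxy
  rw [sandwichedDelta_eq, sandwichedDelta_eq]
  by_cases ht : logNorm ρ σ Φ U γ = ⊤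
  · rw [ht, EReal.coe_mul_top_of_pos (by positivity)]
    exact le_top
  have hR : (Φ ρ).PosSemidef := hU.2 ρ ▸ partialTrace_conj_posSemidef hρ.1 U
  have hS : (Φ σ).PosSemidef := hU.2 σ ▸ partialTrace_conj_posSemidef hσ U
  have key : logNorm ρ σ Φ U α ≤ ((dualParam α / dualParam γ : ℝ) : EReal) *
      logNorm ρ σ Φ U γ := by
    refine logNorm_le_mul (by positivity) ht fun V hV W hW => ?_
    -- Interpolation at `α'` between `0`, where the bound is `1`, and `γ'`; only the factor with
    -- weight `α' / γ'` survives.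
    have h := schattenNorm_le_interp (isTameMatrix_complexChain (ρ := ρ) hσ hR hS U V W)
      (by norm_num) hx hxy (dualParam_le_one hγ2) zero_le_one ENNReal.toReal_nonneg
      (dualBound_complexChain_zero hσ hR hS U V W hρ hU.1 hV hW)
      (dualBound_complexChain hσ hR hS U V W (one_le_two_mul hγ2) (half_one_add_dualParam hγ2)
        (fun V hV W hW => schattenNorm_le_exp_logNorm ht hV hW) hV hW)
      (ENNReal.mul_ne_top ENNReal.ofNat_ne_top hαγ.ne_top) (two_mul_toReal hα2 hαγ.ne_top)
    rwa [complexChain_ofReal, Real.one_rpow, one_mul, sub_zero, sub_zero] at h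
  calc _ ≤ ((2 / dualParam α : ℝ) : EReal) *
        (((dualParam α / dualParam γ : ℝ) : EReal) * logNorm ρ σ Φ U γ) :=
        mul_le_mul_of_nonneg_left key (EReal.coe_nonneg.2 (by positivity))
    _ = _ := by
        rw [← mul_assoc, ← EReal.coe_mul, div_mul_div_cancel₀ hx.ne']

lemma sandwichedDelta_le_of_lt_one (hρ : IsDensity ρ) (hσ : σ.PosSemidef)
    (hU : IsIsometricExtension Φ U) (hα : 1 / 2 ≤ α) (hαγ : α < γ) (hγ : γ < 1) :
    sandwichedDelta ρ σ Φ U α ≤ sandwichedDelta ρ σ Φ U γ := by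
  have hγ2 := hα.trans hαγ.le
  have hy := dualParam_neg hγ2 hγ
  have hxy := dualParam_lt hα hαγ
  have hx := hxy.trans hy
  rw [sandwichedDelta_eq, sandwichedDelta_eq]
  by_cases ht : logNorm ρ σ Φ U α = ⊤
  · rw [ht, EReal.coe_mul_top_of_neg (div_neg_of_pos_of_neg two_pos hx)]
    exact bot_le
  have hR : (Φ ρ).PosSemidef := hU.2 ρ ▸ partialTrace_conj_posSemidef hρ.1 U
  have hS : (Φ σ).PosSemidef := hU.2 σ ▸ partialTrace_conj_posSemidef hσ U
  have key : logNorm ρ σ Φ U γ ≤ ((dualParam γ / dualParam α : ℝ) : EReal) *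
      logNorm ρ σ Φ U α := by
    refine logNorm_le_mul (div_nonneg_of_nonpos hy.le hx.le) ht fun V hV W hW => ?_
    -- Now `γ'` lies between `α'` and `0`. The prefactor `2 / γ'` is negative and reverses the
    -- resulting inequality.
    have h := schattenNorm_le_interp (isTameMatrix_complexChain (ρ := ρ) hσ hR hS U V W)
      (neg_one_le_dualParam hα) hxy hy zero_le_one ENNReal.toReal_nonneg zero_le_one
      (dualBound_complexChain hσ hR hS U V W (one_le_two_mul hα) (half_one_add_dualParam hα)
        (fun V hV W hW => schattenNorm_le_exp_logNorm ht hV hW) hV hW)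
      (dualBound_complexChain_zero hσ hR hS U V W hρ hU.1 hV hW)
      (ENNReal.mul_ne_top ENNReal.ofNat_ne_top hγ.ne_top) (two_mul_toReal hγ2 hγ.ne_top)
    have e : 1 - (dualParam γ - dualParam α) / (0 - dualParam α) = dualParam γ / dualParam α := by
      have := hx.ne
      field_simp
      ring
    rwa [complexChain_ofReal, Real.one_rpow, mul_one, e] at h
  calc _ = ((2 / dualParam γ : ℝ) : EReal) *
        (((dualParam γ / dualParam α : ℝ) : EReal) * logNorm ρ σ Φ U α) := by
        rw [← mul_assoc, ← EReal.coe_mul, div_mul_div_cancel₀ hy.ne]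
    _ ≤ _ := by
        rw [mul_comm, mul_comm _ (logNorm ρ σ Φ U γ)]
        exact EReal.mul_le_mul_of_nonpos_right key
          (EReal.coe_nonpos.2 (div_nonpos_of_nonneg_of_nonpos two_pos.le hy.le))

lemma sandwichedDelta_le_of_supp_le (hρ : IsDensity ρ) (hσ : σ.PosSemidef)
    (hU : IsIsometricExtension Φ U) (hα : 1 / 2 ≤ α)
    (hα1 : α < 1) (hγ : 1 < γ) (hsupp : supp ρ ≤ supp σ) :
    sandwichedDelta ρ σ Φ U α ≤ sandwichedDelta ρ σ Φ U γ := by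
  have hγ2 := hα.trans (hα1.trans hγ).le
  have hx := dualParam_neg hα hα1
  have hy := dualParam_pos hγ
  rw [sandwichedDelta_eq, sandwichedDelta_eq]
  by_cases htα : logNorm ρ σ Φ U α = ⊤
  · rw [htα, EReal.coe_mul_top_of_neg (div_neg_of_pos_of_neg two_pos hx)]
    exact bot_le
  by_cases htγ : logNorm ρ σ Φ U γ = ⊤
  · rw [htγ, EReal.coe_mul_top_of_pos (by positivity)]
    exact le_top
  have hR : (Φ ρ).PosSemidef := hU.2 ρ ▸ partialTrace_conj_posSemidef hρ.1 U
  have hS : (Φ σ).PosSemidef := hU.2 σ ▸ partialTrace_conj_posSemidef hσ U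
  -- Interpolation at `0` with trivial swivels, where the norm is exactly one, so the weighted
  -- product of the two maxima is at least one.
  have key := schattenNorm_le_interp (r := 0) (p := 2)
    (isTameMatrix_complexChain (ρ := ρ) hσ hR hS U 1 1)
    (neg_one_le_dualParam hα) hx hy (dualParam_le_one hγ2) ENNReal.toReal_nonneg
    ENNReal.toReal_nonneg
    (dualBound_complexChain hσ hR hS U 1 1 (one_le_two_mul hα) (half_one_add_dualParam hα)
      (fun V hV W hW => schattenNorm_le_exp_logNorm htα hV hW) one_mem_swivels one_mem_swivels)
    (dualBound_complexChain hσ hR hS U 1 1 (one_le_two_mul hγ2) (half_one_add_dualParam hγ2)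
      (fun V hV W hW => schattenNorm_le_exp_logNorm htγ hV hW) one_mem_swivels one_mem_swivels)
    ENNReal.ofNat_ne_top (by norm_num)
  rw [complexChain_ofReal, hU.2 ρ, hU.2 σ, realChain_zero_of_supp_le hρ.1 hσ hsupp,
    schattenNorm_two_isometry_mul hρ hU.1] at key
  set x := dualParam α
  set y := dualParam γ
  have hyx : 0 < y - x := by linarith
  have e1 : 1 - (0 - x) / (y - x) = y / (y - x) := by
    field_simp
    ring
  rw [e1, zero_sub] at key
  set a := (logNorm ρ σ Φ U α).exp.toReal with ha
  set b := (logNorm ρ σ Φ U γ).exp.toReal with hb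
  have hexp : ∀ L : EReal, L ≠ ⊤ → 0 < L.exp.toReal → L = (Real.log L.exp.toReal : EReal) := by
    intro L hL hpos
    have ht : L.exp ≠ ⊤ := by rwa [ne_eq, ← ENNReal.log_eq_top_iff, EReal.log_exp]
    rw [← ENNReal.log_ofReal_of_pos hpos, ENNReal.ofReal_toReal ht, EReal.log_exp]
  -- A product that is at least one has no vanishing factor, so both suprema are finite and real
  -- logarithms apply.
  have ha0 : 0 < a := by
    refine lt_of_le_of_ne ENNReal.toReal_nonneg fun h => ?_
    rw [← h, Real.zero_rpow (by positivity), zero_mul] at key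
    linarith
  have hb0 : 0 < b := by
    refine lt_of_le_of_ne ENNReal.toReal_nonneg fun h => ?_
    rw [← h, Real.zero_rpow (div_pos (neg_pos.2 hx) hyx).ne', mul_zero] at key
    linarith
  rw [hexp _ htα ha0, hexp _ htγ hb0, ← ha, ← hb, ← EReal.coe_mul, ← EReal.coe_mul,
    EReal.coe_le_coe_iff]
  have hlog := Real.log_nonneg key
  rw [Real.log_mul (Real.rpow_pos_of_pos ha0 _).ne' (Real.rpow_pos_of_pos hb0 _).ne',
    Real.log_rpow ha0, Real.log_rpow hb0] at hlog
  have hlog2 : 0 ≤ y * Real.log a - x * Real.log b := by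
    have := mul_nonneg hyx.le hlog
    have e : (y - x) * (y / (y - x) * Real.log a + -x / (y - x) * Real.log b) =
        y * Real.log a - x * Real.log b := by
      field_simp
      ring
    rwa [e] at this
  -- The denominator `y * -x` is positive since `x < 0 < y`.
  have hdiff : 2 / y * Real.log b - 2 / x * Real.log a =
      2 * (y * Real.log a - x * Real.log b) / (y * -x) := by
    have := hx.ne
    field_simp
    ring
  have : 0 ≤ 2 * (y * Real.log a - x * Real.log b) / (y * -x) :=
    div_nonneg (by linarith) (mul_nonneg hy.le (by linarith))
  linarith

end LogNorm

end SwiveledRenyi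

theorem theorem3 {n k e : Type*} [Fintype n] [DecidableEq n] [Fintype k] [DecidableEq k]
    [Fintype e] [DecidableEq e] (ρ σ : Matrix n n ℂ) (N : Matrix n n ℂ →ₗ[ℂ] Matrix k k ℂ)
    (hρ : SwiveledRenyi.IsDensity ρ) (hσ : σ.PosSemidef) (hσ0 : σ ≠ 0)
    (hN : SwiveledRenyi.IsQuantumChannel N)
    (U : Matrix (k × e) n ℂ) (hU : SwiveledRenyi.IsIsometricExtension N U)
    (α γ : ℝ≥0∞) (hα : 1 / 2 ≤ α) (hαγ : α ≤ γ) (hα1 : α ≠ 1) (hγ1 : γ ≠ 1)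
    (hsupp : α < 1 → 1 < γ → SwiveledRenyi.supp ρ ≤ SwiveledRenyi.supp σ) :
    SwiveledRenyi.sandwichedDelta ρ σ N U α ≤ SwiveledRenyi.sandwichedDelta ρ σ N U γ := by
  rcases hαγ.eq_or_lt with rfl | hlt
  · exact le_rfl
  rcases lt_or_gt_of_ne hα1 with h1 | h1
  · rcases lt_or_gt_of_ne hγ1 with h2 | h2
    · exact SwiveledRenyi.sandwichedDelta_le_of_lt_one hρ hσ hU hα hlt h2
    · exact SwiveledRenyi.sandwichedDelta_le_of_supp_le hρ hσ hU hα h1 h2 (hsupp h1 h2)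
  · exact SwiveledRenyi.sandwichedDelta_le_of_one_lt hρ hσ hU h1 hlt
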